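/- Let $k\ge 1$ and $n\ge 1$ be integers. A $k$-player XOR game $G=(\pi,A)$ with $n$ inputs per player consists of a probability distribution $\pi=(\pi_{i_1,\dots,i_k})$ on $\{1,\dots,n\}^k$ and an array $A=(A_{i_1,\dots,i_k})$ with entries in $\{\pm1\}$, indexed by $\{1,\dots,n\}^k$. Its classical bias is \[ \beta(G)=\max_{x^1,\dots,x^k\in\{\pm1\}^n}\left|\sum_{i_1,\dots,i_k=1}^n \pi_{i_1,\dots,i_k}A_{i_1,\dots,i_k}\,x^1_{i_1}\cdots x^k_{i_k}\right|. \] Corollary. There is a universal constant $c>0$ such that for all integers $k\ge1$ and $n\ge 1$ and every $k$-player XOR game $G$ with $n$ inputs per player, \[ \beta(G)\ \ge\ c\,k^{-3/2}\,n^{-(k-1)/2}. \] -/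

import Mathlib

/-- A `k`-player XOR game with `n` inputs per player. An input tuple `i` assigns to each player `j`
the input `i j`; it is drawn from the probability distribution `π`, and `A i ∈ {±1}` is the value
which the product of the players' answers has to equal for the players to win. -/
structure XORGame (k n : ℕ) where
  π : (Fin k → Fin n) → ℝ
  π_nonneg : ∀ i, 0 ≤ π i
  π_sum : ∑ i, π i = 1
  A : (Fin k → Fin n) → ℤˣ

namespace XORGame

/-- The value `∑ i, π i * A i * x¹(i₁) ⋯ xᵏ(iₖ)` of the multilinear form of the game at the
deterministic strategy `x`, in which player `j` answers `x j a ∈ {±1}` on input `a`. -/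
def value {k n : ℕ} (G : XORGame k n) (x : Fin k → Fin n → ℤˣ) : ℝ :=
  ∑ i : Fin k → Fin n, G.π i * ((G.A i : ℤ) : ℝ) * ∏ j : Fin k, ((x j (i j) : ℤ) : ℝ)

/-- The classical bias `β(G)`: the maximum over all deterministic strategies of the absolute
value of the multilinear form of the game. -/
noncomputable def bias {k n : ℕ} (G : XORGame k n) : ℝ :=
  (Finset.univ : Finset (Fin k → Fin n → ℤˣ)).sup' Finset.univ_nonempty fun x => |G.value x|

end XORGame

/-! The coefficients `π * A` have ℓ¹ norm 1. For a form in `m` variables bounded by `M` on signs,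
Bohnenblust–Hille bounds the ℓᵖ norm of the coefficients, `p = 2m/(m+1)`, by `m * M`. Hölder over `n
^ m` entries turns this into an ℓ¹ bound at the cost of `n ^ ((m-1)/2)`. Hence `1 ≤ k β n ^
((k-1)/2)`, which is stronger than required.

Bohnenblust–Hille is an induction on the number of variables. Fixing signs in one variable leaves a
form in one variable fewer; averaging over these signs with Khintchine bounds a mixed ℓ²–ℓᵖ norm for
each choice of variable, and Blei's inequality combines these bounds. -/

open scoped NNReal

/-- Hölder's inequality for a finite family of functions on a finite type. -/
theorem NNReal.sum_prod_rpow_le {ι α : Type*} [Fintype ι] [Fintype α] (f : ι → α → ℝ≥0)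
    (w : ι → ℝ) (hw : ∀ i, 0 ≤ w i) (hw1 : ∑ i, w i = 1) :
    ∑ a, ∏ i, f i a ^ w i ≤ ∏ i, (∑ a, f i a) ^ w i := by
  let _ : MeasurableSpace α := ⊤
  have h := ENNReal.lintegral_prod_norm_pow_le (μ := MeasureTheory.Measure.count)
    Finset.univ (f := fun i a => ((f i a : ℝ≥0) : ENNReal))
    (fun i _ => (measurable_from_top).aemeasurable) hw1 (fun i _ => hw i)
  simp only [MeasureTheory.lintegral_count, tsum_fintype] at h
  have e (i : ι) (x : ℝ≥0) : ((x : ENNReal)) ^ w i = ((x ^ w i : ℝ≥0) : ENNReal) :=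
    (ENNReal.coe_rpow_of_nonneg _ (hw i)).symm
  simp only [← ENNReal.ofNNReal_finsetSum, e, ← ENNReal.ofNNReal_finsetProd] at h
  exact_mod_cast h

/-- Hölder's inequality for two functions, in interpolation form. -/
theorem NNReal.sum_rpow_mul_rpow_le {α : Type*} [Fintype α] (f g : α → ℝ≥0) {s t : ℝ}
    (hs : 0 ≤ s) (ht : 0 ≤ t) (hst : s + t = 1) :
    ∑ a, f a ^ s * g a ^ t ≤ (∑ a, f a) ^ s * (∑ a, g a) ^ t := by
  have h := NNReal.sum_prod_rpow_le ![f, g] ![s, t]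
    (by intro i; fin_cases i <;> simp [hs, ht]) (by simp [hst])
  simpa using h

/-! ### Loomis–Whitney and Blei inequalities -/

theorem Fin.sum_univ_cons {M α : Type*} [AddCommMonoid M] [Fintype α] {k : ℕ}
    (f : (Fin (k + 1) → α) → M) :
    ∑ i, f i = ∑ a, ∑ i' : Fin k → α, f (Fin.cons a i') := by
  rw [← Fintype.sum_prod_type']
  exact (Equiv.sum_comp (Fin.consEquiv fun _ : Fin (k + 1) => α) f).symm

theorem Fin.sum_univ_insertNth {M α : Type*} [AddCommMonoid M] [Fintype α] {k : ℕ}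
    (j : Fin (k + 1)) (f : (Fin (k + 1) → α) → M) :
    ∑ i, f i = ∑ i' : Fin k → α, ∑ a, f (j.insertNth a i') := by
  rw [Finset.sum_comm, ← Fintype.sum_prod_type']
  exact (Equiv.sum_comp (Fin.insertNthEquiv (fun _ : Fin (k + 1) => α) j) f).symm

theorem Fin.removeNth_succ_cons {α : Type*} {k : ℕ} (j : Fin (k + 1)) (a : α)
    (i : Fin (k + 1) → α) :
    j.succ.removeNth (Fin.cons a i : Fin (k + 2) → α) = Fin.cons a (j.removeNth i) := by
  funext l
  refine Fin.cases ?_ (fun l => ?_) l <;> simp [Fin.removeNth]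

/-- The **Loomis–Whitney inequality** for functions on a finite grid. -/
theorem loomis_whitney {α : Type*} [Fintype α] (k : ℕ)
    (g : Fin (k + 2) → (Fin (k + 1) → α) → ℝ≥0) :
    ∑ i : Fin (k + 2) → α, ∏ j, g j (j.removeNth i) ^ (1 / ((k : ℝ) + 1)) ≤
      ∏ j, (∑ i, g j i) ^ (1 / ((k : ℝ) + 1)) := by
  induction k with
  | zero =>
    simp only [Fin.sum_univ_cons (k := 0 + 1), Fin.sum_univ_cons (k := 0),
      Finset.univ_unique, Finset.sum_singleton, Nat.cast_zero, zero_add, div_one, NNReal.rpow_one]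
    have h2 (f : Fin (0 + 2) → ℝ≥0) : ∏ j, f j = f 0 * f 1 := Fin.prod_univ_two f
    rw [h2, Finset.sum_comm, Finset.sum_mul_sum]
    refine le_of_eq (Finset.sum_congr rfl fun a _ => Finset.sum_congr rfl fun b _ => ?_)
    rw [h2]
    congr 2
    all_goals exact funext fun l => by fin_cases l; rfl
  | succ k ih =>
    have hk : (0 : ℝ) < (k : ℝ) + 1 := by positivity
    have hk2 : (0 : ℝ) < (k : ℝ) + 2 := by positivity
    have ecast : ((k + 1 : ℕ) : ℝ) + 1 = (k : ℝ) + 2 := by push_cast; ring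
    simp only [ecast]
    set s : ℝ := 1 / ((k : ℝ) + 2) with hs
    set t : ℝ := ((k : ℝ) + 1) / ((k : ℝ) + 2) with ht
    have hst : s + t = 1 := by rw [hs, ht]; field_simp; ring
    have hs' : 1 / ((k : ℝ) + 1) * t = s := by rw [hs, ht]; field_simp
    -- On the slice with first coordinate `a`, factor 0 does not see `a`: Hölder splits it off, and
    -- induction treats the others.
    have key (a : α) : ∑ i : Fin (k + 2) → α,
        ∏ j, g j (j.removeNth (Fin.cons a i : Fin (k + 3) → α)) ^ s ≤
        (∑ i, g 0 i) ^ s * ∏ j : Fin (k + 2), (∑ i, g j.succ (Fin.cons a i)) ^ s := by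
      calc ∑ i : Fin (k + 2) → α, ∏ j, g j (j.removeNth (Fin.cons a i : Fin (k + 3) → α)) ^ s
          = ∑ i : Fin (k + 2) → α, g 0 i ^ s *
            (∏ j : Fin (k + 2), g j.succ (Fin.cons a (j.removeNth i)) ^ (1 / ((k : ℝ) + 1))) ^ t := by
            refine Finset.sum_congr rfl fun i _ => ?_
            rw [Fin.prod_univ_succ, ← NNReal.finsetProd_rpow]
            simp only [Fin.removeNth_succ_cons, ← NNReal.rpow_mul, hs']
            simp
        _ ≤ (∑ i, g 0 i) ^ s * (∑ i : Fin (k + 2) → α, ∏ j : Fin (k + 2),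
              g j.succ (Fin.cons a (j.removeNth i)) ^ (1 / ((k : ℝ) + 1))) ^ t :=
            NNReal.sum_rpow_mul_rpow_le _ _ (by positivity) (by positivity) hst
        _ ≤ (∑ i, g 0 i) ^ s * (∏ j : Fin (k + 2),
              (∑ i, g j.succ (Fin.cons a i)) ^ (1 / ((k : ℝ) + 1))) ^ t := by
            gcongr
            exact ih fun j i => g j.succ (Fin.cons a i)
        _ = _ := by
            rw [← NNReal.finsetProd_rpow]
            simp only [← NNReal.rpow_mul, hs']
    rw [Fin.sum_univ_cons, Fin.prod_univ_succ]
    refine (Finset.sum_le_sum fun a _ => key a).trans ?_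
    rw [← Finset.mul_sum]
    gcongr
    simp only [fun j : Fin (k + 2) => Fin.sum_univ_cons (g j.succ)]
    refine NNReal.sum_prod_rpow_le (fun (j : Fin (k + 2)) a => ∑ i, g j.succ (Fin.cons a i))
      (fun _ => s) (fun _ => by positivity) ?_
    simp [hs]; field_simp

/-- **Blei's inequality**, for mixed `ℓ²` and `ℓᵖ` norms in which the `ℓ²` norm is taken in a single
variable. -/
theorem sum_rpow_le_of_mixed_norm_le {α : Type*} [Fintype α] (k : ℕ)
    (a : (Fin (k + 2) → α) → ℝ≥0) (S : ℝ≥0)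
    (h : ∀ j : Fin (k + 2),
      ∑ i : Fin (k + 1) → α, (∑ b, a (j.insertNth b i) ^ 2) ^ (((k : ℝ) + 1) / (k + 2)) ≤ S) :
    ∑ i, a i ^ (2 * ((k : ℝ) + 2) / (k + 3)) ≤ S ^ (((k : ℝ) + 2) ^ 2 / ((k + 3) * (k + 1))) := by
  have hk1 : (0 : ℝ) < (k : ℝ) + 1 := by positivity
  have hk2 : (0 : ℝ) < (k : ℝ) + 2 := by positivity
  have hk3 : (0 : ℝ) < (k : ℝ) + 3 := by positivity
  set F : Fin (k + 2) → (Fin (k + 1) → α) → ℝ≥0 := fun j i => ∑ b, a (j.insertNth b i) ^ 2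
    with hF
  have hFa (j) (i : Fin (k + 2) → α) : a i ^ 2 ≤ F j (j.removeNth i) := by
    have := Finset.single_le_sum (f := fun b => a (j.insertNth b (j.removeNth i)) ^ 2)
      (fun _ _ => zero_le) (Finset.mem_univ (i j))
    simpa only [Fin.insertNth_self_removeNth] using this
  -- The power of `F j` in `u` is chosen so that summing `a ^ 2` along variable `j` gives the
  -- hypothesis, while `v` is suited to Loomis–Whitney. In the final interpolation the powers of `F
  -- j` cancel.
  set u : (Fin (k + 2) → α) → ℝ≥0 := fun i =>
    ∏ j, (a i ^ 2 * F j (j.removeNth i) ^ (-1 / ((k : ℝ) + 2))) ^ (1 / ((k : ℝ) + 2)) with hu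
  set v : (Fin (k + 2) → α) → ℝ≥0 := fun i =>
    ∏ j, (F j (j.removeNth i) ^ (((k : ℝ) + 1) / (k + 2))) ^ (1 / ((k : ℝ) + 1)) with hv
  have hu_sum : ∑ i, u i ≤ S := by
    calc ∑ i, u i ≤ ∏ j, (∑ i, a i ^ 2 * F j (j.removeNth i) ^ (-1 / ((k : ℝ) + 2))) ^
          (1 / ((k : ℝ) + 2)) :=
          NNReal.sum_prod_rpow_le (fun (j : Fin (k + 2)) i =>
            a i ^ 2 * F j (j.removeNth i) ^ (-1 / ((k : ℝ) + 2))) (fun _ => 1 / ((k : ℝ) + 2))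
            (fun _ => by positivity) (by simp; field_simp)
      _ ≤ ∏ j : Fin (k + 2), S ^ (1 / ((k : ℝ) + 2)) := by
          refine Finset.prod_le_prod' fun j _ => ?_
          gcongr
          refine le_trans (le_of_eq ?_) (h j)
          rw [Fin.sum_univ_insertNth j]
          refine Finset.sum_congr rfl fun i _ => ?_
          simp only [Fin.removeNth_insertNth]
          rw [← Finset.sum_mul]
          change F j i * _ = F j i ^ _
          have e : ((k : ℝ) + 1) / (k + 2) = 1 + -1 / ((k : ℝ) + 2) := by field_simp; ring
          rw [e, NNReal.rpow_add' (by rw [← e]; positivity), NNReal.rpow_one]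
      _ = S := by
          rw [Finset.prod_const, ← NNReal.rpow_natCast, ← NNReal.rpow_mul]
          simp only [Finset.card_univ, Fintype.card_fin]
          push_cast
          rw [one_div, inv_mul_cancel₀ hk2.ne', NNReal.rpow_one]
  have hv_sum : ∑ i, v i ≤ S ^ (((k : ℝ) + 2) / (k + 1)) := by
    calc ∑ i, v i ≤ ∏ j, (∑ i, F j i ^ (((k : ℝ) + 1) / (k + 2))) ^ (1 / ((k : ℝ) + 1)) :=
          loomis_whitney k fun j i => F j i ^ (((k : ℝ) + 1) / (k + 2))
      _ ≤ ∏ j : Fin (k + 2), S ^ (1 / ((k : ℝ) + 1)) := by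
          refine Finset.prod_le_prod' fun j _ => ?_
          gcongr
          exact h j
      _ = _ := by
          rw [Finset.prod_const, ← NNReal.rpow_natCast, ← NNReal.rpow_mul]
          simp only [Finset.card_univ, Fintype.card_fin]
          push_cast
          congr 1
          ring
  have huv (i) : a i ^ (2 * ((k : ℝ) + 2) / (k + 3)) ≤
      u i ^ (((k : ℝ) + 2) / (k + 3)) * v i ^ (1 / ((k : ℝ) + 3)) := by
    rcases eq_or_ne (a i) 0 with h0 | h0
    · rw [h0, NNReal.zero_rpow (by positivity)]
      exact zero_le
    have hFpos (j) : F j (j.removeNth i) ≠ 0 :=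
      (lt_of_lt_of_le (by positivity) (hFa j i)).ne'
    have h1 : u i ^ (((k : ℝ) + 2) / (k + 3)) * v i ^ (1 / ((k : ℝ) + 3)) =
        ∏ _j : Fin (k + 2), a i ^ (2 / ((k : ℝ) + 3)) := by
      rw [hu, hv, ← NNReal.finsetProd_rpow, ← NNReal.finsetProd_rpow, ← Finset.prod_mul_distrib]
      refine Finset.prod_congr rfl fun j _ => ?_
      rw [← NNReal.rpow_mul, NNReal.mul_rpow, ← NNReal.rpow_natCast, ← NNReal.rpow_mul,
        ← NNReal.rpow_mul, ← NNReal.rpow_mul, ← NNReal.rpow_mul, mul_assoc,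
        ← NNReal.rpow_add (hFpos j)]
      have e1 : -1 / ((k : ℝ) + 2) * (1 / (k + 2) * ((k + 2) / (k + 3))) +
          (k + 1) / (k + 2) * (1 / (k + 1) * (1 / (k + 3))) = 0 := by field_simp; ring
      rw [e1, NNReal.rpow_zero, mul_one]
      congr 1
      push_cast
      field_simp
    rw [h1, Finset.prod_const, ← NNReal.rpow_natCast, ← NNReal.rpow_mul]
    simp only [Finset.card_univ, Fintype.card_fin]
    refine le_of_eq ?_
    congr 1
    push_cast
    ring
  calc ∑ i, a i ^ (2 * ((k : ℝ) + 2) / (k + 3))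
      ≤ ∑ i, u i ^ (((k : ℝ) + 2) / (k + 3)) * v i ^ (1 / ((k : ℝ) + 3)) :=
        Finset.sum_le_sum fun i _ => huv i
    _ ≤ (∑ i, u i) ^ (((k : ℝ) + 2) / (k + 3)) * (∑ i, v i) ^ (1 / ((k : ℝ) + 3)) :=
        NNReal.sum_rpow_mul_rpow_le _ _ (by positivity) (by positivity) (by field_simp; ring)
    _ ≤ S ^ (((k : ℝ) + 2) / (k + 3)) * (S ^ (((k : ℝ) + 2) / (k + 1))) ^ (1 / ((k : ℝ) + 3)) := by
        gcongr
    _ = _ := by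
        rw [← NNReal.rpow_mul, ← NNReal.rpow_add_of_nonneg _ (by positivity) (by positivity)]
        congr 1
        field_simp
        ring

/-! ### Moments of Rademacher sums -/

theorem sum_units_int {M : Type*} [AddCommMonoid M] (f : ℤˣ → M) : ∑ x, f x = f 1 + f (-1) := by
  rw [UnitsInt.univ, Finset.sum_pair (by decide)]

theorem sum_sq_rademacher (n : ℕ) (c : Fin n → ℝ) :
    ∑ x : Fin n → ℤˣ, (∑ a, c a * ((x a : ℤ) : ℝ)) ^ 2 = 2 ^ n * ∑ a, c a ^ 2 := by
  induction n with
  | zero => simp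
  | succ n ih =>
    rw [Fin.sum_univ_cons, sum_units_int, ← Finset.sum_add_distrib,
      Fin.sum_univ_succ (fun a => c a ^ 2)]
    have h : ∀ x : Fin n → ℤˣ,
        (∑ a, c a * (((Fin.cons 1 x : Fin (n + 1) → ℤˣ) a : ℤ) : ℝ)) ^ 2 +
        (∑ a, c a * (((Fin.cons (-1) x : Fin (n + 1) → ℤˣ) a : ℤ) : ℝ)) ^ 2 =
        2 * (∑ a, c a.succ * ((x a : ℤ) : ℝ)) ^ 2 + 2 * c 0 ^ 2 := by
      intro x
      simp only [Fin.sum_univ_succ, Fin.cons_zero, Fin.cons_succ]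
      push_cast
      ring
    simp only [h, Finset.sum_add_distrib, ← Finset.mul_sum, ih fun a => c a.succ]
    simp [pow_succ]
    ring

theorem sum_pow_four_rademacher_le (n : ℕ) (c : Fin n → ℝ) :
    ∑ x : Fin n → ℤˣ, (∑ a, c a * ((x a : ℤ) : ℝ)) ^ 4 ≤ 3 * 2 ^ n * (∑ a, c a ^ 2) ^ 2 := by
  induction n with
  | zero => simp
  | succ n ih =>
    rw [Fin.sum_univ_cons, sum_units_int, ← Finset.sum_add_distrib,
      Fin.sum_univ_succ (fun a => c a ^ 2)]
    have h : ∀ x : Fin n → ℤˣ,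
        (∑ a, c a * (((Fin.cons 1 x : Fin (n + 1) → ℤˣ) a : ℤ) : ℝ)) ^ 4 +
        (∑ a, c a * (((Fin.cons (-1) x : Fin (n + 1) → ℤˣ) a : ℤ) : ℝ)) ^ 4 =
        2 * (∑ a, c a.succ * ((x a : ℤ) : ℝ)) ^ 4 +
        (12 * c 0 ^ 2 * (∑ a, c a.succ * ((x a : ℤ) : ℝ)) ^ 2 + 2 * c 0 ^ 4) := by
      intro x
      simp only [Fin.sum_univ_succ, Fin.cons_zero, Fin.cons_succ]
      push_cast
      ring
    simp only [h, Finset.sum_add_distrib, ← Finset.mul_sum, sum_sq_rademacher]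
    have := ih fun a => c a.succ
    have h0 : 0 ≤ (2 : ℝ) ^ n * c 0 ^ 4 := by positivity
    have hcard : ∑ _x : Fin n → ℤˣ, c 0 ^ 4 = 2 ^ n * c 0 ^ 4 := by simp
    rw [hcard, pow_succ (2 : ℝ) n]
    linarith

/-- **Khintchine's inequality** for the exponent `p = 2(k+1)/(k+2)`, with a constant which tends to
`1` as `p` tends to `2`. -/
theorem khintchine (k n : ℕ) (c : Fin n → ℝ) :
    2 ^ n * (∑ a, ‖c a‖₊ ^ 2) ^ (((k : ℝ) + 1) / (k + 2)) ≤
      3 ^ (1 / ((k : ℝ) + 2)) *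
        ∑ x : Fin n → ℤˣ, ‖∑ a, c a * ((x a : ℤ) : ℝ)‖₊ ^ (2 * ((k : ℝ) + 1) / (k + 2)) := by
  have hk1 : (0 : ℝ) < (k : ℝ) + 1 := by positivity
  have hk2 : (0 : ℝ) < (k : ℝ) + 2 := by positivity
  have hk3 : (0 : ℝ) < (k : ℝ) + 3 := by positivity
  set s : (Fin n → ℤˣ) → ℝ≥0 := fun x => ‖∑ a, c a * ((x a : ℤ) : ℝ)‖₊ with hs
  set V : ℝ≥0 := ∑ a, ‖c a‖₊ ^ 2 with hV
  set P : ℝ≥0 := ∑ x, s x ^ (2 * ((k : ℝ) + 1) / (k + 2)) with hP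
  change 2 ^ n * V ^ (((k : ℝ) + 1) / (k + 2)) ≤ 3 ^ (1 / ((k : ℝ) + 2)) * P
  have h2 : ∑ x, s x ^ 2 = 2 ^ n * V := by
    rw [← NNReal.coe_inj]
    simp only [hs, hV, NNReal.coe_sum, NNReal.coe_mul, NNReal.coe_pow, coe_nnnorm, Real.norm_eq_abs,
      sq_abs, NNReal.coe_ofNat]
    exact sum_sq_rademacher n c
  have h4 : ∑ x, s x ^ 4 ≤ 3 * 2 ^ n * V ^ 2 := by
    rw [← NNReal.coe_le_coe]
    simp only [hs, hV, NNReal.coe_sum, NNReal.coe_mul, NNReal.coe_pow, coe_nnnorm, Real.norm_eq_abs,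
      sq_abs, NNReal.coe_ofNat, Even.pow_abs (by decide : Even 4)]
    exact sum_pow_four_rademacher_le n c
  rcases eq_or_ne V 0 with hV0 | hV0
  · rw [hV0, NNReal.zero_rpow (by positivity), mul_zero]
    exact zero_le
  -- Hölder interpolates the second moment between the `p`-th and the fourth; solving for `P` leaves
  -- the constant `3 ^ (1 / (k + 2))`.
  have h : 2 ^ n * V ≤ P ^ (((k : ℝ) + 2) / (k + 3)) * (3 * 2 ^ n * V ^ 2) ^ (1 / ((k : ℝ) + 3)) := by
    calc 2 ^ n * V = ∑ x, (s x ^ (2 * ((k : ℝ) + 1) / (k + 2))) ^ (((k : ℝ) + 2) / (k + 3)) *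
          (s x ^ 4) ^ (1 / ((k : ℝ) + 3)) := by
          rw [← h2]
          refine Finset.sum_congr rfl fun x _ => ?_
          rw [← NNReal.rpow_natCast, ← NNReal.rpow_natCast, ← NNReal.rpow_mul, ← NNReal.rpow_mul,
            ← NNReal.rpow_add_of_nonneg _ (by positivity) (by positivity)]
          congr 1
          push_cast
          field_simp
          ring
      _ ≤ P ^ (((k : ℝ) + 2) / (k + 3)) * (∑ x, s x ^ 4) ^ (1 / ((k : ℝ) + 3)) :=
          NNReal.sum_rpow_mul_rpow_le _ _ (by positivity) (by positivity) (by field_simp; ring)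
      _ ≤ _ := by gcongr
  have h' := NNReal.rpow_le_rpow h (show 0 ≤ ((k : ℝ) + 3) / (k + 2) by positivity)
  rw [NNReal.mul_rpow, NNReal.mul_rpow, ← NNReal.rpow_mul, ← NNReal.rpow_mul, NNReal.mul_rpow,
    NNReal.mul_rpow, ← NNReal.rpow_natCast V, ← NNReal.rpow_mul V] at h'
  have e1 : ((k : ℝ) + 2) / (k + 3) * ((k + 3) / (k + 2)) = 1 := by field_simp
  have e2 : 1 / ((k : ℝ) + 3) * ((k + 3) / (k + 2)) = 1 / (k + 2) := by field_simp
  have e3 : ((k : ℝ) + 3) / (k + 2) = 1 + 1 / (k + 2) := by field_simp; ring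
  have e4 : ((k : ℝ) + 3) / (k + 2) = (k + 1) / (k + 2) + (2 : ℕ) * (1 / (k + 2)) := by
    push_cast; field_simp; ring
  rw [e1, e2, NNReal.rpow_one] at h'
  nth_rewrite 1 [e3] at h'
  rw [e4, NNReal.rpow_add (by positivity), NNReal.rpow_add hV0, NNReal.rpow_one] at h'
  have hpos : 0 < ((2 : ℝ≥0) ^ n) ^ (1 / ((k : ℝ) + 2)) * V ^ ((2 : ℕ) * (1 / ((k : ℝ) + 2))) := by
    have : 0 < V := pos_iff_ne_zero.2 hV0
    positivity
  refine le_of_mul_le_mul_right ?_ hpos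
  calc _ = _ := by ring
    _ ≤ _ := h'
    _ = _ := by ring

/-! ### Bohnenblust–Hille inequality -/

/-- The value at signs `x` of the multilinear form with coefficients `T`. -/
def signForm {k n : ℕ} (T : (Fin k → Fin n) → ℝ) (x : Fin k → Fin n → ℤˣ) : ℝ :=
  ∑ i, T i * ∏ j, ((x j (i j) : ℤ) : ℝ)

/-- The frozen form has Rademacher sums as coefficients, so the induction hypothesis bounds exactly
what Khintchine produces. -/
theorem signForm_insertNth {k n : ℕ} (T : (Fin (k + 1) → Fin n) → ℝ) (j : Fin (k + 1))
    (y : Fin n → ℤˣ) (x : Fin k → Fin n → ℤˣ) :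
    signForm T (j.insertNth y x) =
      signForm (fun i => ∑ a, T (j.insertNth a i) * ((y a : ℤ) : ℝ)) x := by
  unfold signForm
  rw [Fin.sum_univ_insertNth j]
  refine Finset.sum_congr rfl fun i _ => ?_
  rw [Finset.sum_mul]
  refine Finset.sum_congr rfl fun a _ => ?_
  rw [Fin.prod_univ_succAbove _ j]
  simp [mul_assoc]

theorem sum_nnnorm_le_of_signForm_le {n : ℕ} (T : (Fin 1 → Fin n) → ℝ) (M : ℝ≥0)
    (h : ∀ x, ‖signForm T x‖₊ ≤ M) : ∑ i, ‖T i‖₊ ≤ M := by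
  set x : Fin 1 → Fin n → ℤˣ := fun _ a => if 0 ≤ T (fun _ => a) then 1 else -1 with hx
  have e : signForm T x = ∑ i, ‖T i‖ := by
    refine Finset.sum_congr rfl fun i _ => ?_
    have hi : (fun _ => i 0) = i := by funext l; fin_cases l; rfl
    rw [Fin.prod_univ_one, hx]
    simp only [hi]
    split_ifs with h0
    · simp [abs_of_nonneg h0]
    · simp [abs_of_neg (not_le.1 h0)]
  have := h x
  rw [← NNReal.coe_le_coe, coe_nnnorm, e, Real.norm_of_nonneg (by positivity)] at this
  rw [← NNReal.coe_le_coe]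
  simpa using this

/-- By Bernoulli, `(1 + 1/(k+1)) ^ (2(k+1)) ≥ 3`. This absorbs the Khintchine loss, so each new
variable adds only 1 to the constant. -/
theorem three_rpow_mul_le (k : ℕ) :
    (3 : ℝ≥0) ^ (1 / (2 * ((k : ℝ) + 1))) * (k + 1) ≤ k + 2 := by
  have hk1 : (0 : ℝ) < (k : ℝ) + 1 := by positivity
  have hb := one_add_mul_le_pow (a := 1 / ((k : ℝ) + 1))
    (by have : 0 < 1 / ((k : ℝ) + 1) := by positivity
        linarith) (2 * (k + 1))
  have e : 1 + ((2 * (k + 1) : ℕ) : ℝ) * (1 / ((k : ℝ) + 1)) = 3 := by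
    push_cast; field_simp; norm_num
  rw [e] at hb
  have hb' : (3 : ℝ≥0) ≤ (1 + 1 / ((k : ℝ≥0) + 1)) ^ (2 * (k + 1)) := by
    rw [← NNReal.coe_le_coe]
    push_cast
    exact hb
  have h := NNReal.rpow_le_rpow hb' (show 0 ≤ 1 / (2 * ((k : ℝ) + 1)) by positivity)
  rw [← NNReal.rpow_natCast, ← NNReal.rpow_mul] at h
  have e2 : ((2 * (k + 1) : ℕ) : ℝ) * (1 / (2 * ((k : ℝ) + 1))) = 1 := by
    push_cast; field_simp
  rw [e2, NNReal.rpow_one] at h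
  calc _ ≤ (1 + 1 / ((k : ℝ≥0) + 1)) * (k + 1) := by gcongr
    _ = k + 2 := by field_simp; ring

/-- The **Bohnenblust–Hille inequality** for real multilinear forms in `k + 1` variables, with
constant `k + 1`. -/
theorem bohnenblust_hille (k n : ℕ) (T : (Fin (k + 1) → Fin n) → ℝ) (M : ℝ≥0)
    (h : ∀ x, ‖signForm T x‖₊ ≤ M) :
    ∑ i, ‖T i‖₊ ^ (2 * ((k : ℝ) + 1) / (k + 2)) ≤
      ((k + 1) * M) ^ (2 * ((k : ℝ) + 1) / (k + 2)) := by
  induction k with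
  | zero => simpa using sum_nnnorm_le_of_signForm_le T M h
  | succ k ih =>
    have hk1 : (0 : ℝ) < (k : ℝ) + 1 := by positivity
    have hk2 : (0 : ℝ) < (k : ℝ) + 2 := by positivity
    have hk3 : (0 : ℝ) < (k : ℝ) + 3 := by positivity
    have hmixed (j : Fin (k + 2)) : ∑ i : Fin (k + 1) → Fin n,
        (∑ b, ‖T (j.insertNth b i)‖₊ ^ 2) ^ (((k : ℝ) + 1) / (k + 2)) ≤
        3 ^ (1 / ((k : ℝ) + 2)) * ((k + 1) * M) ^ (2 * ((k : ℝ) + 1) / (k + 2)) := by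
      have hpos : (0 : ℝ≥0) < 2 ^ n := by positivity
      refine le_of_mul_le_mul_left ?_ hpos
      rw [Finset.mul_sum]
      refine (Finset.sum_le_sum fun i _ => khintchine k n fun a => T (j.insertNth a i)).trans ?_
      -- With the signs `y` outermost, induction applies for each `y`, and the `2 ^ n` terms match
      -- the factor on the left.
      rw [← Finset.mul_sum, Finset.sum_comm]
      calc _ ≤ 3 ^ (1 / ((k : ℝ) + 2)) *
            ∑ _y : Fin n → ℤˣ, ((k + 1) * M) ^ (2 * ((k : ℝ) + 1) / (k + 2)) := by
            gcongr with y
            refine ih _ fun x => ?_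
            rw [← signForm_insertNth]
            exact h _
        _ = _ := by
            simp
            ring
    have hblei := sum_rpow_le_of_mixed_norm_le k (fun i => ‖T i‖₊) _ hmixed
    have ek1 : ((k + 1 : ℕ) : ℝ) + 1 = k + 2 := by push_cast; ring
    have ek2 : ((k + 1 : ℕ) : ℝ) + 2 = k + 3 := by push_cast; ring
    have ek3 : ((k + 1 : ℕ) : ℝ≥0) + 1 = k + 2 := by push_cast; ring
    rw [ek1, ek2, ek3]
    refine hblei.trans ?_
    calc _ = (3 ^ (1 / (2 * ((k : ℝ) + 1))) * (k + 1) * M) ^ (2 * ((k : ℝ) + 2) / (k + 3)) := by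
          rw [mul_assoc, NNReal.mul_rpow, NNReal.mul_rpow (x := 3 ^ (1 / (2 * ((k : ℝ) + 1)))),
            ← NNReal.rpow_mul, ← NNReal.rpow_mul, ← NNReal.rpow_mul]
          congr 2 <;> field_simp
      _ ≤ _ := by
          gcongr
          exact three_rpow_mul_le k

/-! ### From the ℓ¹ bound to the bias -/

theorem sum_nnnorm_le (k n : ℕ) (T : (Fin (k + 1) → Fin n) → ℝ) (M : ℝ≥0)
    (h : ∀ x, ‖signForm T x‖₊ ≤ M) :
    ∑ i, ‖T i‖₊ ≤ (k + 1) * M * (n : ℝ≥0) ^ ((k : ℝ) / 2) := by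
  have hk1 : (0 : ℝ) < (k : ℝ) + 1 := by positivity
  have hk2 : (0 : ℝ) < (k : ℝ) + 2 := by positivity
  set p : ℝ := 2 * ((k : ℝ) + 1) / (k + 2) with hp
  have hp0 : 0 < p := by positivity
  calc ∑ i, ‖T i‖₊ = ∑ i, (‖T i‖₊ ^ p) ^ (1 / p) * (1 : ℝ≥0) ^ ((k : ℝ) / (2 * (k + 1))) := by
        refine Finset.sum_congr rfl fun i _ => ?_
        rw [← NNReal.rpow_mul, mul_one_div_cancel hp0.ne', NNReal.rpow_one, NNReal.one_rpow, mul_one]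
    _ ≤ (∑ i, ‖T i‖₊ ^ p) ^ (1 / p) *
          (∑ _i : Fin (k + 1) → Fin n, (1 : ℝ≥0)) ^ ((k : ℝ) / (2 * (k + 1))) :=
        NNReal.sum_rpow_mul_rpow_le _ _ (by positivity) (by positivity)
          (by rw [hp]; field_simp; ring)
    _ ≤ (((k + 1) * M) ^ p) ^ (1 / p) *
          (∑ _i : Fin (k + 1) → Fin n, (1 : ℝ≥0)) ^ ((k : ℝ) / (2 * (k + 1))) := by
        gcongr
        exact bohnenblust_hille k n T M h
    _ = _ := by
        rw [← NNReal.rpow_mul, mul_one_div_cancel hp0.ne', NNReal.rpow_one]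
        simp only [Finset.sum_const, Finset.card_univ, Fintype.card_pi, Fintype.card_fin,
          Finset.prod_const, nsmul_eq_mul, mul_one, Nat.cast_pow]
        rw [← NNReal.rpow_natCast, ← NNReal.rpow_mul]
        congr 2
        push_cast
        field_simp

theorem XORGame.abs_value_le_bias {k n : ℕ} (G : XORGame k n) (x : Fin k → Fin n → ℤˣ) :
    |G.value x| ≤ G.bias :=
  Finset.le_sup' (fun x => |G.value x|) (Finset.mem_univ x)

theorem XORGame.one_le_mul_bias {k n : ℕ} (G : XORGame (k + 1) n) :
    1 ≤ ((k : ℝ) + 1) * G.bias * (n : ℝ) ^ ((k : ℝ) / 2) := by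
  have hb : 0 ≤ G.bias := (abs_nonneg _).trans (G.abs_value_le_bias fun _ _ => 1)
  have h := sum_nnnorm_le k n (fun i => G.π i * ((G.A i : ℤ) : ℝ)) (⟨G.bias, hb⟩ : ℝ≥0) fun x => by
    exact NNReal.coe_le_coe.1 (G.abs_value_le_bias x)
  have hA (i) : ‖G.π i * ((G.A i : ℤ) : ℝ)‖ = G.π i := by
    rw [norm_mul, Real.norm_of_nonneg (G.π_nonneg i)]
    rcases Int.units_eq_one_or (G.A i) with h | h <;> simp [h]
  rw [← NNReal.coe_le_coe] at h
  push_cast at h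
  simp only [hA, G.π_sum] at h
  exact h

theorem mainTheorem5 :
    ∃ c : ℝ, 0 < c ∧ ∀ k n : ℕ, 1 ≤ k → ∀ G : XORGame k n,
      c * ((k : ℝ) ^ (-(3 / 2) : ℝ) * (n : ℝ) ^ (-((k : ℝ) - 1) / 2)) ≤ G.bias := by
  refine ⟨1, one_pos, fun k n hk G => ?_⟩
  obtain ⟨k, rfl⟩ := Nat.exists_eq_succ_of_ne_zero (Nat.one_le_iff_ne_zero.1 hk)
  -- For `n = 0` there are no input tuples, so no probability distribution.
  have hn : 0 < n := by
    rcases Nat.eq_zero_or_pos n with rfl | hn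
    · have := G.π_sum
      simp at this
    · exact hn
  have h := G.one_le_mul_bias
  have hk1 : (1 : ℝ) ≤ (k : ℝ) + 1 := by simp
  have hn' : (0 : ℝ) < n := by exact_mod_cast hn
  have e : -((k : ℝ) + 1 - 1) / 2 = -((k : ℝ) / 2) := by ring
  simp only [one_mul, Nat.succ_eq_add_one, Nat.cast_succ, e]
  -- The exponent `-1` is what the argument yields; `-3/2` is weaker.
  calc ((k : ℝ) + 1) ^ (-(3 / 2) : ℝ) * (n : ℝ) ^ (-((k : ℝ) / 2))
      ≤ ((k : ℝ) + 1) ^ (-1 : ℝ) * (n : ℝ) ^ (-((k : ℝ) / 2)) := by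
        gcongr
        norm_num
    _ ≤ ((k : ℝ) + 1) ^ (-1 : ℝ) * (n : ℝ) ^ (-((k : ℝ) / 2)) *
          (((k : ℝ) + 1) * G.bias * (n : ℝ) ^ ((k : ℝ) / 2)) :=
        le_mul_of_one_le_right (by positivity) h
    _ = G.bias := by
        rw [Real.rpow_neg_one, Real.rpow_neg hn'.le]
        field_simp
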